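/- Let $(\Omega,\mathfrak{M},\mu)$ be a measure space with finite measure $\mu$ and let $X$ be a metrizable space. Let $M_\mu(X)$ denote the set of all $\mathfrak{M}$-measurable functions $f\colon\Omega\to X$ with separable image ($f^{-1}(U)\in\mathfrak{M}$ for every open $U\subset X$), identified when they are equal $\mu$-almost everywhere, and equipped with the topology of convergence in measure: it is metrizable, and $f_n\to f$ if and only if every subsequence of $(f_n)_n$ has a further subsequence converging to $f$ $\mu$-almost everywhere. A subset $B$ of a Polish space $Y$ is called absolutely measurable in $Y$ if for every Borel probability measure $P$ on $Y$ there are Borel sets $A\subset B\subset C$ in $Y$ with $P(C\setminus A)=0$. A separable metrizable space $S$ is called absolutely measurable if for every topological embedding $\varphi$ of $S$ into the Hilbert cube $Q=[0,1]^{\mathbb{N}}$ the set $\varphi(S)$ is absolutely measurable in $Q$. A Souslin space is a metrizable space that is empty or a continuous image of the space of all irrational numbers (equivalently, of $\mathbb{N}^{\mathbb{N}}$). A metrizable space is an AM-space [respectively, a So-space] if each of its closed separable subsets is, as a subspace, absolutely measurable [respectively, a Souslin space]. Theorem. For every finite measure space $(\Omega,\mathfrak{M},\mu)$: if $X$ is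 an AM-space, then $M_\mu(X)$ is an AM-space; and if $X$ is a So-space, then $M_\mu(X)$ is a So-space. -/

import Mathlib

open MeasureTheory TopologicalSpace Filter Topology

universe u v

/-- The space `M_μ(X)`: measurable functions `Ω → X` with separable image, up to equality
`μ`-almost everywhere. Mathlib's `Ω →ₘ[μ] X` is exactly this when `X` is metrizable, as there
`StronglyMeasurable f` means that `f` is Borel measurable and that its range is separable. -/
def MSpace {Ω : Type u} [MeasurableSpace Ω] (μ : Measure Ω) (X : Type v) [TopologicalSpace X] :
    Type (max u v) :=
  Ω →ₘ[μ] X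

namespace MSpace

variable {Ω : Type u} [MeasurableSpace Ω] {μ : Measure Ω} {X : Type v} [TopologicalSpace X]

/-- A representative `Ω → X` of an element of `M_μ(X)`. -/
noncomputable def rep (f : MSpace μ X) : Ω → X :=
  AEEqFun.cast (μ := μ) (β := X) f

/-- Convergence in measure (for a finite measure): every subsequence of `(g n)` has a further
subsequence that converges to `f` almost everywhere. -/
def SeqConv (g : ℕ → MSpace μ X) (f : MSpace μ X) : Prop :=
  ∀ s : ℕ → ℕ, StrictMono s → ∃ t : ℕ → ℕ, StrictMono t ∧
    ∀ᵐ ω ∂μ, Tendsto (fun n => (g (s (t n))).rep ω) atTop (𝓝 (f.rep ω))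

/-- The topology of convergence in measure: the open sets are the sequentially open ones. For
metrizable `X` and finite `μ` its convergent sequences are exactly those of `SeqConv`
(see `MSpace.tendsto_iff_seqConv`). -/
instance instTopologicalSpace : TopologicalSpace (MSpace μ X) where
  IsOpen U := ∀ f ∈ U, ∀ g : ℕ → MSpace μ X, SeqConv g f → ∀ᶠ n in atTop, g n ∈ U
  isOpen_univ := fun _ _ _ _ => Eventually.of_forall fun _ => Set.mem_univ _
  isOpen_inter := fun _ _ hU hV f hf g hg => (hU f hf.1 g hg).and (hV f hf.2 g hg)
  isOpen_sUnion := fun _ hS f ⟨U, hUS, hfU⟩ g hg =>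
    (hS U hUS f hfU g hg).mono fun _ hn => ⟨U, hUS, hn⟩

/-- Convergence of sequences in the topology of `M_μ(X)` is convergence in measure. -/
theorem tendsto_iff_seqConv [IsFiniteMeasure μ] [MetrizableSpace X] {g : ℕ → MSpace μ X}
    {f : MSpace μ X} : Tendsto g atTop (𝓝 f) ↔ SeqConv g f := by
  constructor
  · intro hg
    let _ : MetricSpace X := metrizableSpaceMetric X
    have hm : ∀ h : MSpace μ X, AEStronglyMeasurable h.rep μ := fun h =>
      (AEEqFun.stronglyMeasurable (μ := μ) (β := X) h).aestronglyMeasurable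
    have hae : ∀ h k : MSpace μ X,
        AEMeasurable (fun ω => min 1 (edist (h.rep ω) (k.rep ω))) μ := fun h k =>
      aemeasurable_const.min ((hm h).edist (hm k))
    set D : MSpace μ X → MSpace μ X → ENNReal :=
      fun h k => ∫⁻ ω, min 1 (edist (h.rep ω) (k.rep ω)) ∂μ with hD
    have key : ∀ (k h : MSpace μ X) (u : ℕ → MSpace μ X), SeqConv u h →
        Tendsto (fun n => D (u n) k) atTop (𝓝 (D h k)) := by
      intro k h u hu
      refine tendsto_of_subseq_tendsto fun ns hns => ?_
      obtain ⟨φ, -, hφ⟩ := strictMono_subseq_of_tendsto_atTop hns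
      obtain ⟨t, ht, hlim⟩ := hu (ns ∘ φ) hφ
      refine ⟨φ ∘ t, ?_⟩
      refine tendsto_lintegral_of_dominated_convergence' (fun _ => 1) (fun n => hae _ _)
        (fun n => ae_of_all _ fun ω => min_le_left _ _) (by simp) ?_
      filter_upwards [hlim] with ω hω
      exact tendsto_const_nhds.min (hω.edist tendsto_const_nhds)
    have h0 : Tendsto (fun n => D (g n) f) atTop (𝓝 0) := by
      rw [ENNReal.tendsto_nhds_zero]
      intro ε hε
      have hop : IsOpen {h : MSpace μ X | D h f < ε} := fun h hh u hu =>
        (key f h u hu).eventually_lt_const hh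
      have hmem : f ∈ {h : MSpace μ X | D h f < ε} := by simpa [hD] using hε
      exact (hg.eventually (hop.mem_nhds hmem)).mono fun n hn => le_of_lt hn
    refine (exists_seq_tendstoInMeasure_atTop_iff fun n => hm (g n)).1 ?_
    refine tendstoInMeasure_of_ne_top fun ε hε hεt => ?_
    have hc0 : min 1 ε ≠ 0 := (lt_min one_pos hε).ne'
    have hct : min 1 ε ≠ ⊤ := ne_top_of_le_ne_top ENNReal.one_ne_top (min_le_left _ _)
    have hdiv : Tendsto (fun n => D (g n) f / min 1 ε) atTop (𝓝 0) := by
      simpa using ENNReal.Tendsto.div_const h0 (Or.inr hc0)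
    refine tendsto_of_tendsto_of_tendsto_of_le_of_le tendsto_const_nhds hdiv
      (fun _ => zero_le) fun n => ?_
    rw [ENNReal.le_div_iff_mul_le (Or.inl hc0) (Or.inl hct), mul_comm]
    refine le_trans ?_ (mul_meas_ge_le_lintegral₀ (hae (g n) f) (min 1 ε))
    exact mul_le_mul' le_rfl (measure_mono fun ω hω => Set.mem_ofPred_eq ▸
      min_le_min le_rfl (Set.mem_ofPred.1 hω))
  · intro hg U hU
    obtain ⟨V, hVU, hV, hf⟩ := mem_nhds_iff.1 hU
    exact mem_map.2 ((hV f hf g hg).mono fun n hn => hVU hn)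

end MSpace

/-- A subset `B` of a Polish space `Y` is absolutely measurable in `Y` if for every Borel
probability measure `P` on `Y` it lies between two Borel sets that differ by a `P`-null set. -/
def AbsolutelyMeasurableIn {Y : Type u} [TopologicalSpace Y] [MeasurableSpace Y] [BorelSpace Y]
    (B : Set Y) : Prop :=
  ∀ P : Measure Y, IsProbabilityMeasure P →
    ∃ A C : Set Y, MeasurableSet A ∧ MeasurableSet C ∧ A ⊆ B ∧ B ⊆ C ∧ P (C \ A) = 0

/-- The Hilbert cube. -/
abbrev HilbertCube : Type := ℕ → unitInterval

/-- Absolutely measurable (separable metrizable) spaces. -/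
structure AbsolutelyMeasurableSpace (S : Type u) [TopologicalSpace S] : Prop where
  separable : SeparableSpace S
  metrizable : MetrizableSpace S
  range_embedding : ∀ φ : S → HilbertCube, IsEmbedding φ → AbsolutelyMeasurableIn (Set.range φ)

/-- AM-spaces: metrizable spaces whose closed separable subsets are absolutely measurable. -/
structure IsAMSpace (X : Type u) [TopologicalSpace X] : Prop where
  metrizable : MetrizableSpace X
  absolutelyMeasurable : ∀ A : Set X, IsClosed A → SeparableSpace A → AbsolutelyMeasurableSpace A

/-- So-spaces: metrizable spaces whose closed separable subsets are Souslin spaces.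
`AnalyticSet A` says that `A` is empty or a continuous image of `ℕ → ℕ`, which is homeomorphic to
the space of irrational numbers. -/
structure IsSoSpace (X : Type u) [TopologicalSpace X] : Prop where
  metrizable : MetrizableSpace X
  souslin : ∀ A : Set X, IsClosed A → SeparableSpace A → AnalyticSet A

/-!
The reason for the theorem is that both properties can be tested on the distributions of the
functions. A closed separable subset `A` of `M_μ(X)` consists of functions with values almost
everywhere in one closed separable subset `Y` of `X`
(`MSpace.exists_isClosed_isSeparable_forall_ae_mem`). An embedding `φ` of `Y` into the Hilbert cube
`Q` induces an embedding of `M_μ(Y)` into the completely metrizable space `M_μ(Q)`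
(`MSpace.isEmbedding_map`, `MSpace.instIsCompletelyMetrizableSpace`). Let `K` be the closure of the
image of `A`. It is Polish, and `A` is homeomorphic to the set of those `u ∈ K` that are almost
everywhere in `φ(Y)` (`MSpace.exists_polishSpace_isEmbedding`). Both cases rest on the fact that the
measure of `{u ∈ F}` is upper semicontinuous in `u` for closed `F`, and jointly so when `F` varies
over the sections of a closed set (`MSpace.isClosed_setOf_le_measure`).

* If `φ(Y)` is absolutely measurable and `P` is a probability measure on `K`, the average of the
  distributions of the `u ∈ K` with respect to `P` is a finite Borel measure on `Q`. Borel sets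
  `B ⊆ φ(Y) ⊆ C` that differ by a null set of this average yield the Borel sets of those `u` that
  are almost everywhere in `B`, or in `C`, and these differ by a `P`-null set
  (`AbsolutelyMeasurableIn.setOf_ae_mem`). Absolute measurability does not depend on the embedding
  into a Polish space (`AbsolutelyMeasurableIn.range_of_isEmbedding`), so that `K` can be replaced
  by the Hilbert cube.
* If `φ(Y)` is the image of `ℕ → ℕ` under a continuous map `p`, then `u` is almost everywhere in
  `φ(Y)` if and only if for each `n` some compact set `p {x | x ≤ b}` contains the values of `u` up
  to measure `1 / (n + 1)`. This is a closed condition on the pair `(u, b)`, so that the set of all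
  such `u` is a countable intersection of projections of closed sets, hence analytic
  (`MeasureTheory.AnalyticSet.setOf_ae_mem`).
-/

namespace MSpace

variable {Ω : Type*} [MeasurableSpace Ω] {μ : Measure Ω}

/-! ### The metric of convergence in measure -/

section Basic

variable {X : Type*} [TopologicalSpace X]

theorem stronglyMeasurable_rep (f : MSpace μ X) : StronglyMeasurable f.rep :=
  AEEqFun.stronglyMeasurable (μ := μ) (β := X) f

/-- The class of an almost everywhere strongly measurable function. -/
noncomputable def mk (f : Ω → X) (hf : AEStronglyMeasurable f μ) : MSpace μ X :=
  AEEqFun.mk f hf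

theorem rep_mk (f : Ω → X) (hf : AEStronglyMeasurable f μ) : (mk f hf).rep =ᵐ[μ] f :=
  AEEqFun.coeFn_mk f hf

theorem ext_of_ae_eq {f g : MSpace μ X} (h : f.rep =ᵐ[μ] g.rep) : f = g :=
  AEEqFun.ext h

end Basic

section Metric

variable {X : Type*} [MetricSpace X]

/-- The distance `∫ min (1, d (f, g)) dμ` of convergence in measure. -/
noncomputable def truncEDist (f g : MSpace μ X) : ENNReal :=
  ∫⁻ ω, min 1 (edist (f.rep ω) (g.rep ω)) ∂μ

theorem aemeasurable_min_edist (f g : MSpace μ X) :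
    AEMeasurable (fun ω => min 1 (edist (f.rep ω) (g.rep ω))) μ :=
  aemeasurable_const.min
    (f.stronglyMeasurable_rep.aestronglyMeasurable.edist
      g.stronglyMeasurable_rep.aestronglyMeasurable)

theorem truncEDist_comm (f g : MSpace μ X) : truncEDist f g = truncEDist g f := by
  simp only [truncEDist, edist_comm]

theorem truncEDist_triangle (f g h : MSpace μ X) :
    truncEDist f h ≤ truncEDist f g + truncEDist g h := by
  rw [truncEDist, truncEDist, truncEDist, ← lintegral_add_left' (aemeasurable_min_edist f g)]
  refine lintegral_mono fun ω => ?_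
  refine (min_le_min le_rfl (edist_triangle (f.rep ω) (g.rep ω) (h.rep ω))).trans ?_
  rcases le_total 1 (edist (f.rep ω) (g.rep ω)) with h1 | h1
  · rw [min_eq_left h1]
    exact (min_le_left _ _).trans le_self_add
  · rw [min_eq_right h1]
    rcases le_total 1 (edist (g.rep ω) (h.rep ω)) with h2 | h2
    · rw [min_eq_left h2]
      exact (min_le_left _ _).trans le_add_self
    · rw [min_eq_right h2]
      exact min_le_right _ _

theorem eq_of_truncEDist_eq_zero {f g : MSpace μ X} (h : truncEDist f g = 0) : f = g := by
  refine ext_of_ae_eq ?_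
  filter_upwards [(lintegral_eq_zero_iff' (aemeasurable_min_edist f g)).1 h] with ω hω
  rcases min_eq_iff.1 hω with h | h
  · exact absurd h.1 one_ne_zero
  · exact edist_eq_zero.1 h.1

variable [IsFiniteMeasure μ]

theorem SeqConv.tendsto_truncEDist {g : ℕ → MSpace μ X} {f : MSpace μ X} (hg : SeqConv g f) :
    Tendsto (fun n => truncEDist (g n) f) atTop (𝓝 0) := by
  refine tendsto_of_subseq_tendsto fun ns hns => ?_
  obtain ⟨φ, -, hφ⟩ := strictMono_subseq_of_tendsto_atTop hns
  obtain ⟨t, ht, hlim⟩ := hg (ns ∘ φ) hφ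
  refine ⟨φ ∘ t, ?_⟩
  have := tendsto_lintegral_of_dominated_convergence' (μ := μ)
    (F := fun n ω => min 1 (edist ((g (ns (φ (t n)))).rep ω) (f.rep ω))) (f := fun _ => 0)
    (fun _ => 1) (fun n => aemeasurable_min_edist _ _)
    (fun n => ae_of_all _ fun ω => min_le_left _ _) (by simp) (by
      filter_upwards [hlim] with ω hω
      simpa using (tendsto_const_nhds (x := (1 : ENNReal))).min
        (hω.edist (tendsto_const_nhds (x := f.rep ω))))
  simpa [truncEDist] using this

theorem seqConv_of_tendsto_truncEDist {g : ℕ → MSpace μ X} {f : MSpace μ X}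
    (h : Tendsto (fun n => truncEDist (g n) f) atTop (𝓝 0)) : SeqConv g f := by
  refine (exists_seq_tendstoInMeasure_atTop_iff
    fun n => (g n).stronglyMeasurable_rep.aestronglyMeasurable).1 ?_
  refine tendstoInMeasure_of_ne_top fun ε hε hεt => ?_
  have hc0 : min 1 ε ≠ 0 := (lt_min one_pos hε).ne'
  have hct : min 1 ε ≠ ⊤ := ne_top_of_le_ne_top ENNReal.one_ne_top (min_le_left _ _)
  have hdiv : Tendsto (fun n => truncEDist (g n) f / min 1 ε) atTop (𝓝 0) := by
    simpa using ENNReal.Tendsto.div_const h (Or.inr hc0)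
  refine tendsto_of_tendsto_of_tendsto_of_le_of_le tendsto_const_nhds hdiv
    (fun _ => zero_le) fun n => ?_
  rw [ENNReal.le_div_iff_mul_le (Or.inl hc0) (Or.inl hct), mul_comm]
  refine le_trans ?_ (mul_meas_ge_le_lintegral₀ (aemeasurable_min_edist (g n) f) (min 1 ε))
  exact mul_le_mul' le_rfl (measure_mono fun ω hω => Set.mem_ofPred_eq ▸
    min_le_min le_rfl (Set.mem_ofPred.1 hω))

/-- The extended metric `truncEDist`, with its own topology. -/
noncomputable abbrev truncEMetricSpace (μ : Measure Ω) (X : Type*) [MetricSpace X] :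
    EMetricSpace (MSpace μ X) where
  edist := truncEDist
  edist_self f := by
    show truncEDist f f = 0
    simp [truncEDist]
  edist_comm := truncEDist_comm
  edist_triangle := truncEDist_triangle
  eq_of_edist_eq_zero := eq_of_truncEDist_eq_zero

theorem topology_eq_truncEMetricSpace :
    (instTopologicalSpace : TopologicalSpace (MSpace μ X)) =
      (truncEMetricSpace μ X).toUniformSpace.toTopologicalSpace := by
  ext U
  rw [@EMetric.isOpen_iff _ (truncEMetricSpace μ X).toPseudoEMetricSpace]
  constructor
  · intro hU f hf
    by_contra! hcon
    have hpos : ∀ n : ℕ, (0 : ENNReal) < ((n : ENNReal) + 1)⁻¹ := fun n => by simp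
    choose g hg hgU using fun n : ℕ => Set.not_subset.1 (hcon _ (hpos n))
    have hlim : Tendsto (fun n : ℕ => ((n : ENNReal) + 1)⁻¹) atTop (𝓝 0) := by
      have := (tendsto_add_atTop_iff_nat 1).2 ENNReal.tendsto_inv_nat_nhds_zero
      simpa using this
    have hconv : SeqConv g f := seqConv_of_tendsto_truncEDist <|
      tendsto_of_tendsto_of_tendsto_of_le_of_le tendsto_const_nhds hlim
        (fun _ => zero_le) fun n => (show truncEDist (g n) f < _ from hg n).le
    obtain ⟨n, hn⟩ := (hU f hf g hconv).exists
    exact hgU n hn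
  · intro hU f hf g hg
    obtain ⟨ε, hε, hball⟩ := hU f hf
    exact (hg.tendsto_truncEDist.eventually_lt_const hε).mono fun n hn => hball hn

/-- The extended metric `truncEDist`, with the topology of convergence in measure. -/
noncomputable abbrev emetricSpace (μ : Measure Ω) [IsFiniteMeasure μ] (X : Type*) [MetricSpace X] :
    EMetricSpace (MSpace μ X) :=
  (truncEMetricSpace μ X).replaceTopology topology_eq_truncEMetricSpace

end Metric

section Complete

variable {X : Type*} [TopologicalSpace X] [IsFiniteMeasure μ]

instance instMetrizableSpace [MetrizableSpace X] : MetrizableSpace (MSpace μ X) := by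
  let := metrizableSpaceMetric X
  let := emetricSpace μ X
  infer_instance

/-- A sequence whose consecutive distances are summable converges almost everywhere. -/
instance instIsCompletelyMetrizableSpace [IsCompletelyMetrizableSpace X] :
    IsCompletelyMetrizableSpace (MSpace μ X) := by
  let := upgradeIsCompletelyMetrizable X
  let := emetricSpace μ X
  have : CompleteSpace (MSpace μ X) := by
    refine EMetric.complete_of_convergent_controlled_sequences (fun n => (2⁻¹ : ENNReal) ^ n)
      (fun n => ENNReal.pow_pos (by simp) n) fun g hg => ?_
    have hsum : ∫⁻ ω, ∑' n, min 1 (edist ((g n).rep ω) ((g (n + 1)).rep ω)) ∂μ ≠ ⊤ := by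
      rw [lintegral_tsum fun n => aemeasurable_min_edist _ _]
      refine ne_top_of_le_ne_top (b := ∑' n : ℕ, (2⁻¹ : ENNReal) ^ n) (by simp) ?_
      exact ENNReal.tsum_le_tsum fun n => (hg n n (n + 1) le_rfl (Nat.le_succ n)).le
    have hlim : ∀ᵐ ω ∂μ, ∃ l, Tendsto (fun n => (g n).rep ω) atTop (𝓝 l) := by
      filter_upwards [ae_lt_top' (AEMeasurable.tsum fun n => aemeasurable_min_edist _ _)
        hsum] with ω hω
      -- The terms tend to `0`, so that the truncation is eventually inactive.
      obtain ⟨N, hN⟩ := eventually_atTop.1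
        ((ENNReal.tendsto_atTop_zero_of_tsum_ne_top hω.ne).eventually_lt_const one_pos)
      have hC : CauchySeq fun n => (g (n + N)).rep ω := by
        refine cauchySeq_of_edist_le_of_tsum_ne_top
          (fun n => min 1 (edist ((g (n + N)).rep ω) ((g (n + N + 1)).rep ω))) (fun n => ?_) ?_
        · have h1 := hN (n + N) (Nat.le_add_left _ _)
          have h2 := (min_lt_iff.1 h1).resolve_left (lt_irrefl _)
          rw [min_eq_right h2.le, Nat.succ_eq_add_one, Nat.add_right_comm]
        · exact ne_top_of_le_ne_top hω.ne
            (ENNReal.tsum_comp_le_tsum_of_injective (add_left_injective N)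
              (fun n => min 1 (edist ((g n).rep ω) ((g (n + 1)).rep ω))))
      obtain ⟨l, hl⟩ := cauchySeq_tendsto_of_complete hC
      exact ⟨l, (tendsto_add_atTop_iff_nat N).1 hl⟩
    obtain ⟨h, hh, hgh⟩ := exists_stronglyMeasurable_limit_of_tendsto_ae
      (fun n => (g n).stronglyMeasurable_rep.aestronglyMeasurable) hlim
    refine ⟨mk h hh.aestronglyMeasurable, tendsto_iff_seqConv.2 fun s hs => ⟨id, strictMono_id, ?_⟩⟩
    filter_upwards [hgh, rep_mk h hh.aestronglyMeasurable] with ω h1 h2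
    rw [h2]
    exact h1.comp hs.tendsto_atTop
  infer_instance

end Complete

/-! ### Functoriality -/

section Map

variable {X Y : Type*} [TopologicalSpace X] [TopologicalSpace Y]

/-- Composition with a continuous map, as a map `M_μ(Y) → M_μ(X)`. -/
noncomputable def map (μ : Measure Ω) (φ : Y → X) (hφ : Continuous φ) (f : MSpace μ Y) :
    MSpace μ X :=
  mk (fun ω => φ (f.rep ω))
    (hφ.comp_aestronglyMeasurable f.stronglyMeasurable_rep.aestronglyMeasurable)

theorem rep_map {φ : Y → X} (hφ : Continuous φ) (f : MSpace μ Y) :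
    (map μ φ hφ f).rep =ᵐ[μ] fun ω => φ (f.rep ω) :=
  rep_mk _ _

variable [MetrizableSpace X] [MetrizableSpace Y]

/-- Both topologies are determined by their convergent sequences, and an embedding preserves and
reflects pointwise convergence. -/
theorem isEmbedding_map [IsFiniteMeasure μ] {φ : Y → X} (hφ : IsEmbedding φ) :
    IsEmbedding (map μ φ hφ.continuous) := by
  have hall : ∀ g : ℕ → MSpace μ Y, ∀ᵐ ω ∂μ, ∀ n,
      (map μ φ hφ.continuous (g n)).rep ω = φ ((g n).rep ω) := fun g =>
    ae_all_iff.2 fun n => rep_map hφ.continuous (g n)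
  have key : ∀ (g : ℕ → MSpace μ Y) (f : MSpace μ Y),
      Tendsto (fun n => map μ φ hφ.continuous (g n)) atTop (𝓝 (map μ φ hφ.continuous f)) ↔
        Tendsto g atTop (𝓝 f) := fun g f => by
    rw [tendsto_iff_seqConv, tendsto_iff_seqConv]
    refine forall₂_congr fun s _ => exists_congr fun t => and_congr_right fun _ => ?_
    refine eventually_congr ?_
    filter_upwards [hall g, rep_map hφ.continuous f] with ω h1 h2
    simp only [h1, h2]
    exact hφ.tendsto_nhds_iff.symm
  refine ⟨isInducing_iff_nhds.2 fun f => le_antisymm ?_ ?_, fun f g hfg => ?_⟩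
  · rw [← map_le_iff_le_comap]
    exact tendsto_of_seq_tendsto fun g hg => (key g f).2 hg
  · have : Tendsto id (comap (map μ φ hφ.continuous) (𝓝 (map μ φ hφ.continuous f))) (𝓝 f) :=
      by
      refine tendsto_of_seq_tendsto fun g hg => (key g f).1 ?_
      exact (tendsto_comap (f := map μ φ hφ.continuous)).comp hg
    exact this
  · refine ext_of_ae_eq ?_
    filter_upwards [rep_map hφ.continuous f, rep_map hφ.continuous g] with ω h1 h2
    exact hφ.injective (by rw [← h1, ← h2, hfg])

/-- The almost everywhere `φ(Y)`-valued functions are those that factor through an embedding `φ`.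
The function `h₀` is only there to rule out that
`Y` is empty while `Ω` is not. -/
theorem mem_range_map_of_ae_mem {φ : Y → X} (hφ : IsEmbedding φ) (h₀ : Ω → Y)
    {g : MSpace μ X} (hg : ∀ᵐ ω ∂μ, g.rep ω ∈ Set.range φ) :
    g ∈ Set.range (map μ φ hφ.continuous) := by
  classical
  let h : Ω → Y := fun ω => if hω : g.rep ω ∈ Set.range φ then hω.choose else h₀ ω
  have hh : ∀ᵐ ω ∂μ, φ (h ω) = g.rep ω := by
    filter_upwards [hg] with ω hω
    simp only [h, dif_pos hω]
    exact hω.choose_spec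
  have hm : AEStronglyMeasurable h μ := hφ.aestronglyMeasurable_comp_iff.1
    (g.stronglyMeasurable_rep.aestronglyMeasurable.congr (hh.mono fun ω h => h.symm))
  refine ⟨mk h hm, ext_of_ae_eq ?_⟩
  filter_upwards [rep_map hφ.continuous (mk h hm), rep_mk h hm, hh] with ω h1 h2 h3
  rw [h1, h2, h3]

end Map

end MSpace

namespace MSpace

variable {Ω : Type*} [MeasurableSpace Ω] {μ : Measure Ω} [IsFiniteMeasure μ]

/-! ### Reduction to a Polish value space -/

section Reduction

variable {X : Type*} [TopologicalSpace X] [MetrizableSpace X]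

/-- `Y` is the closure of the ranges of countably many functions whose closure contains `A`; the maps
`Ω → Y` only serve to rule out that `Y` is empty while `Ω` is not. -/
theorem exists_isClosed_isSeparable_forall_ae_mem {A : Set (MSpace μ X)} (hA : IsSeparable A) :
    ∃ Y : Set X, IsClosed Y ∧ IsSeparable Y ∧
      ∀ f ∈ A, (∀ᵐ ω ∂μ, f.rep ω ∈ Y) ∧ Nonempty (Ω → Y) := by
  let := metrizableSpaceMetric X
  obtain ⟨c, hc, hAc⟩ := hA
  have hsub : ∀ g ∈ c, ∀ ω, g.rep ω ∈ closure (⋃ g ∈ c, Set.range (rep g)) := fun g hg ω =>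
    subset_closure (Set.mem_biUnion hg ⟨ω, rfl⟩)
  refine ⟨closure (⋃ g ∈ c, Set.range g.rep), isClosed_closure, ?_, fun f hf => ⟨?_, ?_⟩⟩
  · have := hc.to_subtype
    rw [Set.biUnion_eq_iUnion]
    exact (isSeparable_iUnion.2 fun g : c =>
      g.1.stronglyMeasurable_rep.isSeparable_range).closure
  · obtain ⟨g, hg, hgf⟩ := mem_closure_iff_seq_limit.1 (hAc hf)
    obtain ⟨t, -, hlim⟩ := tendsto_iff_seqConv.1 hgf id strictMono_id
    filter_upwards [hlim] with ω hω
    exact isClosed_closure.mem_of_tendsto hω (Eventually.of_forall fun n => hsub _ (hg _) ω)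
  · obtain ⟨g, hg⟩ := closure_nonempty_iff.1 ⟨f, hAc hf⟩
    exact ⟨fun ω => ⟨g.rep ω, hsub g hg ω⟩⟩

/-- A closed set of almost everywhere `Y`-valued functions is carried by an embedding of `Y` into
`Q` onto a relatively closed subset of the set of functions with values in the image of `Y`. -/
theorem exists_isEmbedding_range_eq {Q : Type*} [TopologicalSpace Q] [MetrizableSpace Q]
    {A : Set (MSpace μ X)} (hA : IsClosed A) {Y : Set X}
    (hY : ∀ f ∈ A, (∀ᵐ ω ∂μ, f.rep ω ∈ Y) ∧ Nonempty (Ω → Y)) {φ : Y → Q} (hφ : IsEmbedding φ) :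
    ∃ j : A → MSpace μ Q, IsEmbedding j ∧
      Set.range j = {u ∈ closure (Set.range j) | ∀ᵐ ω ∂μ, u.rep ω ∈ Set.range φ} := by
  have hι : IsEmbedding (Subtype.val : Y → X) := IsEmbedding.subtypeVal
  have hlift : ∀ f : A, ∃ h : MSpace μ Y, map μ Subtype.val hι.continuous h = f := fun f =>
    mem_range_map_of_ae_mem hι (hY f f.2).2.some (by simpa using (hY f f.2).1)
  choose l hl using hlift
  have hlemb : IsEmbedding l := by
    rw [← IsEmbedding.of_comp_iff (isEmbedding_map hι)]
    convert (IsEmbedding.subtypeVal : IsEmbedding (Subtype.val : A → MSpace μ X)) using 1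
    exact funext hl
  have hlrange : Set.range l = map μ Subtype.val hι.continuous ⁻¹' A := by
    ext h
    constructor
    · rintro ⟨f, rfl⟩
      exact Set.mem_preimage.2 ((hl f).symm ▸ f.2)
    · intro hh
      exact ⟨⟨_, hh⟩, (isEmbedding_map hι).injective (hl _)⟩
  have hlclosed : IsClosed (Set.range l) := hlrange ▸ hA.preimage (isEmbedding_map hι).continuous
  refine ⟨map μ φ hφ.continuous ∘ l, (isEmbedding_map hφ).comp hlemb,
    Set.Subset.antisymm ?_ ?_⟩
  · rintro _ ⟨f, rfl⟩
    refine ⟨subset_closure ⟨f, rfl⟩, ?_⟩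
    filter_upwards [rep_map hφ.continuous (l f)] with ω hω
    exact ⟨_, hω.symm⟩
  · rintro u ⟨hu, hφu⟩
    obtain ⟨_, f, -⟩ := closure_nonempty_iff.1 ⟨u, hu⟩
    obtain ⟨h, rfl⟩ := mem_range_map_of_ae_mem hφ (hY f f.2).2.some hφu
    rw [Set.range_comp] at hu ⊢
    refine ⟨h, ?_, rfl⟩
    rw [← hlclosed.closure_eq, (isEmbedding_map hφ).isInducing.closure_eq_preimage_closure_image]
    exact hu

end Reduction

/-! ### Semicontinuity of distributions -/

section Semicontinuity

variable {Q : Type*} [TopologicalSpace Q] [MetrizableSpace Q]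

/-- The measure of `{u ∈ F}` for closed `F` is upper semicontinuous in `u` and `F` jointly,
where the sets `F` are the sections of a closed set in a product. -/
theorem isClosed_setOf_le_measure {T : Type*} [TopologicalSpace T] [FirstCountableTopology T]
    {R : Set (T × Q)} (hR : IsClosed R) (r : ENNReal) :
    IsClosed {p : MSpace μ Q × T | r ≤ μ {ω | (p.2, p.1.rep ω) ∈ R}} := by
  borelize Q
  have hmeas : ∀ (u : MSpace μ Q) (t : T), MeasurableSet {ω | (t, u.rep ω) ∈ R} := fun u t =>
    u.stronglyMeasurable_rep.measurable
      (hR.preimage (Continuous.prodMk_right t)).measurableSet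
  refine IsSeqClosed.isClosed fun p q hp hpq => ?_
  obtain ⟨s, hs, hlim⟩ := tendsto_iff_seqConv.1
    ((continuous_fst.tendsto q).comp hpq) id strictMono_id
  have ht : Tendsto (fun n => (p (s n)).2) atTop (𝓝 q.2) :=
    ((continuous_snd.tendsto q).comp hpq).comp hs.tendsto_atTop
  -- The upper limit of the events along the subsequence has measure at least `r`.
  let E : ℕ → Set Ω := fun n => ⋃ m ≥ n, {ω | ((p (s m)).2, (p (s m)).1.rep ω) ∈ R}
  have hE : Antitone E := fun a b hab => Set.biUnion_subset_biUnion_left fun m hm => hab.trans hm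
  have hr : r ≤ μ (⋂ n, E n) := by
    refine ge_of_tendsto' (tendsto_measure_iInter_atTop (fun n => ?_) hE ⟨0, measure_ne_top _ _⟩)
      fun n => ?_
    · exact (MeasurableSet.iUnion fun m => MeasurableSet.iUnion fun _ =>
        hmeas _ _).nullMeasurableSet
    · exact (hp (s n)).trans (measure_mono (Set.subset_biUnion_of_mem
        (u := fun m => {ω | ((p (s m)).2, (p (s m)).1.rep ω) ∈ R}) (le_refl n)))
  refine hr.trans (measure_mono_ae ?_)
  filter_upwards [hlim] with ω hω hmem
  refine hR.mem_of_frequently_of_tendsto (Filter.frequently_atTop.2 fun n => ?_)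
    (ht.prodMk_nhds hω)
  obtain ⟨m, hm, h⟩ := Set.mem_iUnion₂.1 (Set.mem_iInter.1 hmem n)
  exact ⟨m, hm, h⟩

theorem measurable_map_rep [MeasurableSpace Q] [BorelSpace Q] [MeasurableSpace (MSpace μ Q)]
    [BorelSpace (MSpace μ Q)] : Measurable fun u : MSpace μ Q => μ.map u.rep := by
  have hm : ∀ u : MSpace μ Q, Measurable u.rep := fun u => u.stronglyMeasurable_rep.measurable
  refine Measurable.measure_of_isPiSystem (S := {s : Set Q | IsClosed s})
    ((BorelSpace.measurable_eq).trans borel_eq_generateFrom_isClosed) isPiSystem_isClosed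
    (fun F hF => measurable_of_Ici fun r => ?_) ?_
  · have h1 : IsClosed {u : MSpace μ Q | r ≤ μ {ω | u.rep ω ∈ F}} :=
      (isClosed_setOf_le_measure (μ := μ) (T := Unit) (hF.preimage continuous_snd) r).preimage
        (Continuous.prodMk_left ())
    convert h1.measurableSet using 1
    ext u
    simp [Measure.map_apply (hm u) hF.measurableSet, Set.preimage]
  · simp [Measure.map_apply (hm _) MeasurableSet.univ]

end Semicontinuity

end MSpace

/-! ### Absolutely measurable sets -/

section AbsolutelyMeasurable

variable {Y : Type*} [TopologicalSpace Y] [MeasurableSpace Y] [BorelSpace Y]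

theorem AbsolutelyMeasurableIn.exists_of_isFiniteMeasure {B : Set Y}
    (hB : AbsolutelyMeasurableIn B) (P : Measure Y) [IsFiniteMeasure P] :
    ∃ A C : Set Y, MeasurableSet A ∧ MeasurableSet C ∧ A ⊆ B ∧ B ⊆ C ∧ P (C \ A) = 0 := by
  rcases eq_zero_or_neZero P with rfl | h
  · exact ⟨∅, Set.univ, .empty, .univ, Set.empty_subset _, Set.subset_univ _, rfl⟩
  · obtain ⟨A, C, hA, hC, hAB, hBC, h0⟩ := hB ((P Set.univ)⁻¹ • P) inferInstance
    refine ⟨A, C, hA, hC, hAB, hBC, ?_⟩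
    simpa using h0

/-- Absolute measurability of the image of an embedding into a Polish space does not depend on the
embedding: `S → Z₁` and `S → Z₂` extend to Borel maps between the ambient spaces. -/
theorem AbsolutelyMeasurableIn.range_of_isEmbedding {S Z₁ Z₂ : Type*} [TopologicalSpace S]
    [TopologicalSpace Z₁] [PolishSpace Z₁] [MeasurableSpace Z₁] [BorelSpace Z₁]
    [TopologicalSpace Z₂] [PolishSpace Z₂] [MeasurableSpace Z₂] [BorelSpace Z₂]
    {i : S → Z₁} {j : S → Z₂} (hi : IsEmbedding i) (hj : IsEmbedding j)
    (h : AbsolutelyMeasurableIn (Set.range i)) : AbsolutelyMeasurableIn (Set.range j) := by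
  intro P _
  rcases isEmpty_or_nonempty S with hS | hS
  · exact ⟨∅, ∅, .empty, .empty, Set.empty_subset _,
      (Set.range_eq_empty j).subset, by simp⟩
  have : Nonempty Z₁ := hS.map i
  have : Nonempty Z₂ := hS.map j
  have hi' : MeasurableSpace.comap i inferInstance = borel S := by
    rw [BorelSpace.measurable_eq (α := Z₁), ← borel_comap, ← hi.eq_induced]
  have hj' : MeasurableSpace.comap j inferInstance = borel S := by
    rw [BorelSpace.measurable_eq (α := Z₂), ← borel_comap, ← hj.eq_induced]
  obtain ⟨F, hF, hFi⟩ := Measurable.exists_eq_measurable_comp (f := i) (g := j)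
    (measurable_iff_comap_le.2 (hj'.trans hi'.symm).le)
  obtain ⟨G, hG, hGj⟩ := Measurable.exists_eq_measurable_comp (f := j) (g := i)
    (measurable_iff_comap_le.2 (hi'.trans hj'.symm).le)
  have hFi' : ∀ s, F (i s) = j s := fun s => (congrFun hFi s).symm
  have hGj' : ∀ s, G (j s) = i s := fun s => (congrFun hGj s).symm
  obtain ⟨A, C, hA, hC, hAB, hBC, h0⟩ := h.exists_of_isFiniteMeasure (P.map G)
  rw [Measure.map_apply hG (hC.diff hA)] at h0
  have hfix : MeasurableSet {z | F (G z) = z} := measurableSet_eq_fun (hF.comp hG) measurable_id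
  refine ⟨G ⁻¹' A ∩ {z | F (G z) = z}, G ⁻¹' C ∩ {z | F (G z) = z}, (hG hA).inter hfix,
    (hG hC).inter hfix, ?_, ?_, measure_mono_null ?_ h0⟩
  · rintro z ⟨hz, hFz⟩
    obtain ⟨s, hs⟩ := hAB hz
    exact ⟨s, by rw [← hFi', hs]; exact hFz⟩
  · rintro _ ⟨s, rfl⟩
    refine ⟨?_, ?_⟩
    · rw [Set.mem_preimage, hGj']
      exact hBC ⟨s, rfl⟩
    · rw [Set.mem_ofPred_eq, hGj', hFi']
  · rintro z ⟨⟨hC, hz⟩, hA⟩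
    exact ⟨hC, fun h => hA ⟨h, hz⟩⟩

/-- Integrating the distributions of the functions `F t` over `P` gives a finite measure on `Q`;
Borel sets that enclose `S` up to a null set of this measure also enclose it up to a null set of
the distribution of `F t`, for `P`-almost every `t`. -/
theorem AbsolutelyMeasurableIn.setOf_ae_mem {Ω Q T : Type*} [MeasurableSpace Ω] {μ : Measure Ω}
    [IsFiniteMeasure μ] [TopologicalSpace Q] [MetrizableSpace Q] [MeasurableSpace Q] [BorelSpace Q]
    [TopologicalSpace T] [MeasurableSpace T] [BorelSpace T] {F : T → MSpace μ Q}
    (hF : Continuous F) {S : Set Q} (hS : AbsolutelyMeasurableIn S) :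
    AbsolutelyMeasurableIn {t | ∀ᵐ ω ∂μ, (F t).rep ω ∈ S} := by
  intro P _
  borelize (MSpace μ Q)
  let κ : T → Measure Q := fun t => μ.map (F t).rep
  have hκ : Measurable κ := MSpace.measurable_map_rep.comp hF.measurable
  have hm : ∀ t, Measurable (F t).rep := fun t => (F t).stronglyMeasurable_rep.measurable
  have hκ' : ∀ t {s : Set Q}, MeasurableSet s → κ t s = μ ((F t).rep ⁻¹' s) := fun t s hs =>
    Measure.map_apply (hm t) hs
  have hfin : IsFiniteMeasure (P.bind κ) := ⟨by
    rw [Measure.bind_apply .univ hκ.aemeasurable]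
    simp [hκ' _ MeasurableSet.univ]⟩
  obtain ⟨A, C, hA, hC, hAS, hSC, h0⟩ := hS.exists_of_isFiniteMeasure (P.bind κ)
  have hκs : ∀ {s : Set Q}, MeasurableSet s → MeasurableSet {t | κ t s = 0} := fun hs =>
    ((Measure.measurable_coe hs).comp hκ) (measurableSet_singleton 0)
  refine ⟨{t | κ t Aᶜ = 0}, {t | κ t Cᶜ = 0}, hκs hA.compl, hκs hC.compl, ?_, ?_, ?_⟩
  · intro t ht
    rw [Set.mem_ofPred_eq, hκ' t hA.compl] at ht
    exact (measure_eq_zero_iff_ae_notMem.1 ht).mono fun ω hω => hAS (by simpa using hω)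
  · intro t ht
    rw [Set.mem_ofPred_eq, hκ' t hC.compl]
    exact measure_eq_zero_iff_ae_notMem.2 
      (Eventually.mono ht fun ω hω => by simpa using hSC hω)
  · rw [Measure.bind_apply (hC.diff hA) hκ.aemeasurable,
      lintegral_eq_zero_iff (Measure.measurable_measure.1 hκ _ (hC.diff hA))] at h0
    refine measure_eq_zero_iff_ae_notMem.2 (h0.mono fun t ht => ?_)
    rintro ⟨htC, htA⟩
    refine htA (measure_mono_null (fun q hq => ?_) (measure_union_null htC ht))
    by_cases hqC : q ∈ C
    · exact Or.inr ⟨hqC, hq⟩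
    · exact Or.inl hqC

end AbsolutelyMeasurable

/-! ### Analytic sets -/

section Analytic

/-- The coordinates of `b` are chosen one after another, by continuity of the outer measure along
increasing unions. -/
theorem exists_forall_lt_measure_image {Q : Type*} [MeasurableSpace Q] (P : Measure Q)
    (p : (ℕ → ℕ) → Q) {r : ENNReal} (hr : r < P (Set.range p)) :
    ∃ b : ℕ → ℕ, ∀ k, r < P (p '' {x | ∀ i < k, x i ≤ b i}) := by
  have hstep : ∀ (k : ℕ) (b : {b : ℕ → ℕ // r < P (p '' {x | ∀ i < k, x i ≤ b i})}),
      ∃ b' : {b : ℕ → ℕ // r < P (p '' {x | ∀ i < k + 1, x i ≤ b i})},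
        ∀ i < k, b'.1 i = b.1 i := by
    rintro k ⟨b, hb⟩
    let N : ℕ → Set (ℕ → ℕ) := fun m => {x | (∀ i < k, x i ≤ b i) ∧ x k ≤ m}
    have hU : p '' {x | ∀ i < k, x i ≤ b i} = ⋃ m, p '' N m := by
      rw [← Set.image_iUnion]
      congr 1
      ext x
      simp only [N, Set.mem_iUnion, Set.mem_ofPred_eq]
      exact ⟨fun h => ⟨x k, h, le_rfl⟩, fun ⟨_, h, _⟩ => h⟩
    have hmono : Monotone fun m => p '' N m := fun m m' h =>
      Set.image_mono fun x hx => ⟨hx.1, hx.2.trans h⟩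
    rw [hU, hmono.directed_le.measure_iUnion] at hb
    obtain ⟨m, hm⟩ := lt_iSup_iff.1 hb
    refine ⟨⟨Function.update b k m, hm.trans_le (measure_mono (Set.image_mono ?_))⟩,
      fun i hi => Function.update_of_ne hi.ne _ _⟩
    rintro x ⟨hx, hxk⟩ i hi
    rcases (Nat.lt_succ_iff.1 hi).lt_or_eq with h | rfl
    · rw [Function.update_of_ne h.ne]
      exact hx i h
    · rwa [Function.update_self]
  choose next hnext using hstep
  let B : ∀ k, {b : ℕ → ℕ // r < P (p '' {x | ∀ i < k, x i ≤ b i})} := fun k =>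
    Nat.rec ⟨0, by simpa [Set.image_univ] using hr⟩ next k
  have hB : ∀ k, ∀ i < k, (B k).1 i = (B (i + 1)).1 i := by
    intro k
    induction k with
    | zero => exact fun i hi => absurd hi (Nat.not_lt_zero i)
    | succ k ih =>
      intro i hi
      rcases (Nat.lt_succ_iff.1 hi).lt_or_eq with h | rfl
      · exact (hnext k (B k) i h).trans (ih i h)
      · rfl
  refine ⟨fun i => (B (i + 1)).1 i, fun k => (B k).2.trans_le (measure_mono (Set.image_mono ?_))⟩
  exact fun x hx i hi => (hx i hi).trans (hB k i hi).le

variable {Q : Type*} [TopologicalSpace Q] [MetrizableSpace Q]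

/-- The images of the compact sets `{x | x ≤ b}` are the sections of a closed set. -/
theorem isClosed_setOf_exists_le_eq {p : (ℕ → ℕ) → Q} (hp : Continuous p) :
    IsClosed {q : (ℕ → ℕ) × Q | ∃ x ≤ q.1, p x = q.2} := by
  refine IsSeqClosed.isClosed fun q q₀ hq hlim => ?_
  choose x hx hpx using hq
  have h1 : Tendsto (fun n => (q n).1) atTop (𝓝 q₀.1) := (continuous_fst.tendsto _).comp hlim
  have h2 : Tendsto (fun n => (q n).2) atTop (𝓝 q₀.2) := (continuous_snd.tendsto _).comp hlim
  choose c hc using fun i => ((tendsto_pi_nhds.1 h1) i).bddAbove_range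
  obtain ⟨x₀, -, s, hs, hsx⟩ := (isCompact_univ_pi fun i => (Set.finite_Iic (c i)).isCompact)
    |>.tendsto_subseq (x := x) fun n i _ => (hx n i).trans (hc i ⟨n, rfl⟩)
  refine ⟨x₀, le_of_tendsto_of_tendsto' hsx (h1.comp hs.tendsto_atTop) fun n => hx (s n), ?_⟩
  refine tendsto_nhds_unique ((hp.tendsto x₀).comp hsx) ?_
  exact (h2.comp hs.tendsto_atTop).congr fun n => (hpx (s n)).symm

/-- Inner regularity of a finite Borel measure on the continuous image of `ℕ → ℕ`. -/
theorem exists_le_measure_image_le [MeasurableSpace Q] [BorelSpace Q] (P : Measure Q)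
    [IsFiniteMeasure P] {p : (ℕ → ℕ) → Q} (hp : Continuous p) {r : ENNReal}
    (hr : r < P (Set.range p)) : ∃ b : ℕ → ℕ, r ≤ P {y | ∃ x ≤ b, p x = y} := by
  let := metrizableSpaceMetric Q
  obtain ⟨b, hb⟩ := exists_forall_lt_measure_image P p hr
  refine ⟨b, ?_⟩
  let E : ℕ → Set Q := fun k => closure (p '' {x | ∀ i < k, x i ≤ b i})
  have hE : Antitone E := fun k l hkl =>
    closure_mono (Set.image_mono fun x hx i hi => hx i (hi.trans_le hkl))
  have hrE : r ≤ P (⋂ k, E k) :=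
    ge_of_tendsto' (tendsto_measure_iInter_atTop
      (fun k => isClosed_closure.measurableSet.nullMeasurableSet) hE ⟨0, measure_ne_top _ _⟩)
      fun k => (hb k).le.trans (measure_mono subset_closure)
  refine hrE.trans (measure_mono fun y hy => ?_)
  have hy' : ∀ k : ℕ, ∃ x : ℕ → ℕ, (∀ i < k, x i ≤ b i) ∧ dist y (p x) < 1 / ((k : ℝ) + 1) := by
    intro k
    obtain ⟨_, ⟨x, hx, rfl⟩, hd⟩ :=
      Metric.mem_closure_iff.1 (Set.mem_iInter.1 hy k) _ (Nat.one_div_pos_of_nat (n := k))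
    exact ⟨x, hx, hd⟩
  choose x hx hd using hy'
  -- The bounds `b ⊔ x k` converge to `b`, and `p (x k)` converges to `y`.
  have h1 : Tendsto (fun k => b ⊔ x k) atTop (𝓝 b) := by
    refine tendsto_pi_nhds.2 fun i => tendsto_const_nhds.congr' ?_
    filter_upwards [eventually_gt_atTop i] with k hk
    exact (sup_eq_left.2 (hx k i hk)).symm
  have h2 : Tendsto (fun k => p (x k)) atTop (𝓝 y) := by
    refine tendsto_iff_dist_tendsto_zero.2 (squeeze_zero (fun _ => dist_nonneg) (fun k => ?_)
      tendsto_one_div_add_atTop_nhds_zero_nat)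
    rw [dist_comm]
    exact (hd k).le
  exact (isClosed_setOf_exists_le_eq hp).mem_of_tendsto (h1.prodMk_nhds h2)
    (Eventually.of_forall fun k => ⟨x k, le_sup_right, rfl⟩)

/-- A function is almost everywhere in `p(ℕ → ℕ)` if and only if for every `n` it is in some
`p {x | x ≤ b}` up to a set of measure at most `1 / (n + 1)`. For each `n` this is the projection
of a closed condition on the function and `b`. -/
theorem MeasureTheory.AnalyticSet.setOf_ae_mem {Ω T : Type*} [MeasurableSpace Ω] {μ : Measure Ω}
    [IsFiniteMeasure μ] [TopologicalSpace T] [PolishSpace T] {F : T → MSpace μ Q}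
    (hF : Continuous F) {S : Set Q} (hS : AnalyticSet S) :
    AnalyticSet {t | ∀ᵐ ω ∂μ, (F t).rep ω ∈ S} := by
  rw [AnalyticSet] at hS
  rcases hS with rfl | ⟨p, hp, rfl⟩
  · simp only [Set.mem_empty_iff_false]
    exact (isClosed_const (p := ∀ᵐ ω ∂μ, False)).analyticSet
  borelize Q
  let R := {q : (ℕ → ℕ) × Q | ∃ x ≤ q.1, p x = q.2}
  have hR : IsClosed R := isClosed_setOf_exists_le_eq hp
  have hm : ∀ t, Measurable (F t).rep := fun t => (F t).stronglyMeasurable_rep.measurable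
  let ε : ℕ → ENNReal := fun n => ((n : ENNReal) + 1)⁻¹
  have hε : ∀ n, 0 < ε n := fun n => by simp [ε]
  have hεlim : Tendsto ε atTop (𝓝 0) := by
    have := (tendsto_add_atTop_iff_nat 1).2 ENNReal.tendsto_inv_nat_nhds_zero
    simpa using this
  let C : ℕ → Set (T × (ℕ → ℕ)) := fun n =>
    {q | μ Set.univ - ε n ≤ μ {ω | (q.2, (F q.1).rep ω) ∈ R}}
  have hC : ∀ n, IsClosed (C n) := fun n =>
    (MSpace.isClosed_setOf_le_measure hR (μ Set.univ - ε n)).preimage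
      ((hF.comp continuous_fst).prodMk continuous_snd)
  have heq : {t | ∀ᵐ ω ∂μ, (F t).rep ω ∈ Set.range p} = ⋂ n, Prod.fst '' C n := by
    ext t
    rw [Set.mem_iInter]
    constructor
    · intro ht n
      rcases eq_or_ne (μ Set.univ) 0 with h0 | h0
      · exact ⟨(t, 0), by simp [C, h0], rfl⟩
      have hlt : μ Set.univ - ε n < μ.map (F t).rep (Set.range p) := by
        refine (ENNReal.sub_lt_self (measure_ne_top _ _) h0 (hε n).ne').trans_le ?_
        refine le_trans (measure_mono_ae ?_) (Measure.le_map_apply (hm t).aemeasurable _)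
        exact Eventually.mono ht fun ω hω _ => hω
      obtain ⟨b, hb⟩ := exists_le_measure_image_le _ hp hlt
      refine ⟨(t, b), ?_, rfl⟩
      exact hb.trans_eq (Measure.map_apply (hm t)
        (hR.preimage (Continuous.prodMk_right b)).measurableSet)
    · intro h
      choose q hq hqt using h
      have hb : ∀ n, μ Set.univ - ε n ≤ μ {ω | ((q n).2, (F t).rep ω) ∈ R} := fun n =>
        hqt n ▸ hq n
      have hmeas : MeasurableSet (⋃ n, {ω | ((q n).2, (F t).rep ω) ∈ R}) :=
        MeasurableSet.iUnion fun n =>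
          hm t (hR.preimage (Continuous.prodMk_right (q n).2)).measurableSet
      have hfull : μ Set.univ ≤ μ (⋃ n, {ω | ((q n).2, (F t).rep ω) ∈ R}) := by
        have hlim : Tendsto (fun n => μ Set.univ - ε n) atTop (𝓝 (μ Set.univ - 0)) :=
          ENNReal.Tendsto.sub tendsto_const_nhds hεlim (Or.inl (measure_ne_top _ _))
        rw [tsub_zero] at hlim
        exact le_of_tendsto' hlim fun n => (hb n).trans (measure_mono (Set.subset_iUnion
          (fun n => {ω | ((q n).2, (F t).rep ω) ∈ R}) n))
      have hae := (ae_iff_measure_eq hmeas.nullMeasurableSet).2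
        (le_antisymm (measure_mono (Set.subset_univ _)) hfull)
      refine Eventually.mono hae fun ω hω => ?_
      obtain ⟨n, x, -, hx⟩ := Set.mem_iUnion.1 hω
      exact ⟨x, hx⟩
  rw [heq]
  exact AnalyticSet.iInter fun n => (hC n).analyticSet.image_of_continuous continuous_fst

end Analytic

/-! ### AM-spaces and So-spaces of measurable functions -/

namespace MSpace

variable {Ω : Type*} [MeasurableSpace Ω] (μ : Measure Ω) [IsFiniteMeasure μ]
  {X : Type*} [TopologicalSpace X]

/-- A closed separable set of measurable functions, as the space of those elements of a Polish
space `K ⊆ M_μ(Q)` that are almost everywhere in the image of a closed separable subset of `X`. -/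
theorem exists_polishSpace_isEmbedding [MetrizableSpace X] {A : Set (MSpace μ X)}
    (hA : IsClosed A) (hAs : SeparableSpace A) :
    ∃ (Y : Set X) (φ : Y → HilbertCube) (K : Set (MSpace μ HilbertCube)) (j : A → K),
      IsClosed Y ∧ SeparableSpace Y ∧ IsEmbedding φ ∧ PolishSpace K ∧ IsEmbedding j ∧
        Set.range j = {u : K | ∀ᵐ ω ∂μ, u.1.rep ω ∈ Set.range φ} := by
  let := metrizableSpaceMetric X
  obtain ⟨Y, hYc, hYs, hY⟩ :=
    exists_isClosed_isSeparable_forall_ae_mem (IsSeparable.of_subtype A)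
  have := hYs.separableSpace
  obtain ⟨φ, hφ⟩ := Metric.PiNatEmbed.exists_embedding_to_hilbert_cube (X := Y)
  obtain ⟨j, hj, hrange⟩ := exists_isEmbedding_range_eq hA hY hφ
  have hK : IsSeparable (closure (Set.range j)) := (isSeparable_range hj.continuous).closure
  have := hK.separableSpace
  have := (isClosed_closure (s := Set.range j)).isCompletelyMetrizableSpace
  refine ⟨Y, φ, closure (Set.range j), fun f => ⟨j f, subset_closure ⟨f, rfl⟩⟩, hYc, ‹_›, hφ,
    inferInstance, hj.codRestrict _ _, ?_⟩
  ext u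
  constructor
  · rintro ⟨f, rfl⟩
    exact (hrange.subset ⟨f, rfl⟩).2
  · intro hu
    obtain ⟨f, hf⟩ := hrange.superset ⟨u.2, hu⟩
    exact ⟨f, Subtype.ext hf⟩

theorem isAMSpace (hX : IsAMSpace X) : IsAMSpace (MSpace μ X) := by
  have := hX.metrizable
  refine ⟨inferInstance, fun A hA hAs => ⟨hAs, inferInstance, fun ψ hψ => ?_⟩⟩
  obtain ⟨Y, φ, K, j, hYc, hYs, hφ, hK, hj, hrange⟩ := exists_polishSpace_isEmbedding μ hA hAs
  borelize ↥K
  refine AbsolutelyMeasurableIn.range_of_isEmbedding hj hψ ?_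
  rw [hrange]
  exact ((hX.absolutelyMeasurable Y hYc hYs).range_embedding φ hφ).setOf_ae_mem
    continuous_subtype_val

theorem isSoSpace (hX : IsSoSpace X) : IsSoSpace (MSpace μ X) := by
  have := hX.metrizable
  refine ⟨inferInstance, fun A hA hAs => ?_⟩
  obtain ⟨Y, φ, K, j, hYc, hYs, hφ, hK, hj, hrange⟩ := exists_polishSpace_isEmbedding μ hA hAs
  have hφY : AnalyticSet (Set.range φ) := by
    have hYA := hX.souslin Y hYc hYs
    rw [AnalyticSet] at hYA
    rcases hYA with rfl | ⟨p, hp, rfl⟩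
    · rw [Set.range_eq_empty]
      exact analyticSet_empty
    · rw [← (Set.rangeFactorization_surjective (f := p)).range_comp]
      exact analyticSet_range_of_polishSpace (hφ.continuous.comp (hp.subtype_mk _))
  have hjA : AnalyticSet (Set.range j) := by
    rw [hrange]
    exact hφY.setOf_ae_mem continuous_subtype_val
  rw [AnalyticSet] at hjA
  rcases hjA with h | ⟨p, hp, hpj⟩
  · have := Set.range_eq_empty_iff.1 h
    rw [Set.isEmpty_coe_sort.1 this]
    exact analyticSet_empty
  · have hpA : ∀ x, ∃ f : A, j f = p x := fun x => hpj.subset ⟨x, rfl⟩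
    choose q hq using hpA
    have hqc : Continuous q := hj.continuous_iff.2 (hp.congr fun x => (hq x).symm)
    have hqA : Set.range (fun x => (q x : MSpace μ X)) = A := by
      refine Set.Subset.antisymm (Set.range_subset_iff.2 fun x => (q x).2) fun f hf => ?_
      obtain ⟨x, hx⟩ := hpj.superset ⟨⟨f, hf⟩, rfl⟩
      exact ⟨x, congrArg Subtype.val (hj.injective ((hq x).trans hx))⟩
    rw [← hqA]
    exact analyticSet_range_of_polishSpace (continuous_subtype_val.comp hqc)

end MSpace

theorem mainTheorem7 {Ω : Type u} {X : Type v} [MeasurableSpace Ω] (μ : Measure Ω)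
    [IsFiniteMeasure μ] [TopologicalSpace X] :
    (IsAMSpace X → IsAMSpace (MSpace μ X)) ∧ (IsSoSpace X → IsSoSpace (MSpace μ X)) :=
  ⟨MSpace.isAMSpace μ, MSpace.isSoSpace μ⟩
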